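/- Let $w\ge 2$ be an integer. The Johnson graph $J(2w,w)$ has as vertices the $w$-element subsets of a fixed $2w$-element set, two of them being adjacent if and only if their intersection has $w-1$ elements. A set $C$ of vertices is a $2$-perfect code in $J(2w,w)$ if for each vertex $v$ there is a unique $c\in C$ whose graph distance from $v$ is at most $2$. If a $2$-perfect code exists in $J(2w,w)$, then there is an integer $m\ge 0$ such that $$w=\frac{(1+\sqrt2)^{2m+1}+(1-\sqrt2)^{2m+1}+6}{4}$$ and $$\gamma=\sqrt2\left((1+\sqrt2)^{2m}-(1-\sqrt2)^{2m}\right)+1$$ is the square of an integer. -/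

import Mathlib

/-- The Johnson graph `J(n, w)`: its vertices are the `w`-subsets of an `n`-set, and two of them
are adjacent if and only if their intersection has `w - 1` elements (written without truncated
subtraction as `|s ∩ t| + 1 = w`). -/
def johnsonGraph (n w : ℕ) : SimpleGraph {s : Finset (Fin n) // s.card = w} where
  Adj s t := (s.1 ∩ t.1).card + 1 = w
  symm := ⟨fun s t h => by rwa [Finset.inter_comm]⟩
  loopless := ⟨fun s h => by
    have hs := s.2
    rw [Finset.inter_self] at h
    omega⟩

/-- A set `C` of vertices of a graph is an `e`-perfect code if for each vertex `v` there is a unique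
codeword `c` at graph distance at most `e` from `v`; equivalently, the balls of radius `e` around
the codewords partition the vertex set. (`edist` is the graph distance, equal to `⊤` between
vertices that are not connected.) -/
def SimpleGraph.IsPerfectCode {V : Type*} (G : SimpleGraph V) (e : ℕ) (C : Set V) : Prop :=
  ∀ v : V, ∃! c : V, c ∈ C ∧ G.edist v c ≤ (e : ℕ∞)

/-!
Let `A` be the adjacency operator of `J(2 * w, w)` on real functions on the `w`-sets, realized below
as `exchangeSum`, and let `u` be the indicator function of a `2`-perfect code. The balls of radius
two around the codewords partition the vertices, and the matrix of the relation "at distance at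
most two" is a quadratic polynomial in `A`; this gives `(A - t') (A - t) u = 4` with
`t, t' = w - 3 ∓ √(2 * w ^ 2 - 6 * w + 5)` (`exchangeSum_exchangeSum_indicator`).

Since `A` multiplies constants by `w ^ 2`, the function `F = (A - t') u - 4 / (w ^ 2 - t)` satisfies
`A F = t F`. It does not vanish: at a vertex at distance two from the code both `u` and `A u` are
zero. Hence the particular root `t` is an eigenvalue of `A` (`exists_lloyd_root`). This is the part
of Lloyd's theorem that is needed, and no spectral theory enters.

The eigenvalues of `A` have the form `(w - j) ^ 2 - j` (`exists_eq_of_exchangeSum_eigen`): summing an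
eigenfunction over upper covers in the Boolean lattice shifts its eigenvalue by a known amount, and
just before it vanishes the eigenvalue is minus the size of the sets.

So `t` is an integer, and therefore `y = √(2 * w ^ 2 - 6 * w + 5)` is one, that is,
`(2 * w - 3) ^ 2 - 2 * y ^ 2 = -1`. The solutions of this Pell equation
(`exists_odd_pow_of_negative_pell`) give the formula for `w`, and `t = (w - j) ^ 2 - j` says that
`4 * (2 * w - 3 - y) + 1 = (2 * w + 1 - 2 * j) ^ 2`, where the left side is the number `γ`.
-/

/-! ### The exchange operator and its eigenvalues -/

section Exchange

variable {α : Type*} [Fintype α] [DecidableEq α]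

/-- The sum of `f` over all sets obtained from `S` by exchanging one element of `S` for one element
outside `S`. On the sets of a fixed size this is the adjacency operator of a Johnson graph; it is
defined on functions on all finite sets, so that no subtypes are needed when the size varies. -/
def exchangeSum (f : Finset α → ℝ) (S : Finset α) : ℝ :=
  ∑ x ∈ S, ∑ y ∈ Sᶜ, f (insert y (S.erase x))

/-- The sum of `f` over the upper covers of `S` in the Boolean lattice. -/
def sumInsert (f : Finset α → ℝ) (S : Finset α) : ℝ :=
  ∑ y ∈ Sᶜ, f (insert y S)

/-- The sum of `f` over the lower covers of `S` in the Boolean lattice. -/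
def sumErase (f : Finset α → ℝ) (S : Finset α) : ℝ :=
  ∑ x ∈ S, f (S.erase x)

lemma sumErase_sumInsert (f : Finset α → ℝ) (S : Finset α) :
    sumErase (sumInsert f) S = S.card * f S + exchangeSum f S := by
  have h : ∀ x ∈ S, sumInsert f (S.erase x) =
      f S + ∑ y ∈ Sᶜ, f (insert y (S.erase x)) := by
    intro x hx
    rw [sumInsert, Finset.compl_erase, Finset.sum_insert (by simpa using hx),
      Finset.insert_erase hx]
  rw [sumErase, Finset.sum_congr rfl h, Finset.sum_add_distrib, exchangeSum]
  simp

lemma sumInsert_sumErase (f : Finset α → ℝ) (S : Finset α) :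
    sumInsert (sumErase f) S = (Fintype.card α - S.card) * f S + exchangeSum f S := by
  have h : ∀ y ∈ Sᶜ, sumErase f (insert y S) =
      f S + ∑ x ∈ S, f (insert y (S.erase x)) := by
    intro y hy
    have hy' : y ∉ S := by simpa using hy
    rw [sumErase, Finset.sum_insert hy', Finset.erase_insert hy']
    congr 1
    refine Finset.sum_congr rfl fun x hx => ?_
    rw [Finset.erase_insert_of_ne (by rintro rfl; exact hy' hx)]
  rw [sumInsert, Finset.sum_congr rfl h, Finset.sum_add_distrib, exchangeSum,
    Finset.sum_comm (s := S)]
  simp [Finset.card_compl, Nat.cast_sub (Finset.card_le_univ S)]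

lemma exchangeSum_congr {k : ℕ} {f g : Finset α → ℝ} (h : ∀ S, S.card = k → f S = g S)
    {S : Finset α} (hS : S.card = k) : exchangeSum f S = exchangeSum g S := by
  refine Finset.sum_congr rfl fun x hx => Finset.sum_congr rfl fun y hy => h _ ?_
  have hy' : y ∉ S := by simpa using hy
  rw [Finset.card_insert_of_notMem (fun h => hy' (Finset.mem_of_mem_erase h)),
    Finset.card_erase_add_one hx, hS]

lemma exchangeSum_sub (f g : Finset α → ℝ) (S : Finset α) :
    exchangeSum (fun T => f T - g T) S = exchangeSum f S - exchangeSum g S := by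
  simp [exchangeSum, Finset.sum_sub_distrib]

lemma exchangeSum_const_mul (c : ℝ) (f : Finset α → ℝ) (S : Finset α) :
    exchangeSum (fun T => c * f T) S = c * exchangeSum f S := by
  simp [exchangeSum, Finset.mul_sum]

lemma exchangeSum_const (c : ℝ) (S : Finset α) :
    exchangeSum (fun _ => c) S = S.card * (Fintype.card α - S.card) * c := by
  simp [exchangeSum, Finset.card_compl, Nat.cast_sub (Finset.card_le_univ S), mul_assoc]

lemma exchangeSum_sum {ι : Type*} (s : Finset ι) (f : ι → Finset α → ℝ) (S : Finset α) :
    exchangeSum (fun T => ∑ i ∈ s, f i T) S = ∑ i ∈ s, exchangeSum (f i) S := by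
  simp only [exchangeSum]
  rw [Finset.sum_comm (s := s)]
  exact Finset.sum_congr rfl fun x _ => Finset.sum_comm

/-- Passing to the sums over upper covers shifts exchange eigenvalues: it maps eigenfunctions on
the sets of size `k + 1` to eigenfunctions (or zero) on the sets of size `k`. -/
lemma exchangeSum_sumInsert {k : ℕ} {f : Finset α → ℝ} {t : ℝ}
    (hf : ∀ S : Finset α, S.card = k + 1 → exchangeSum f S = t * f S)
    {R : Finset α} (hR : R.card = k) :
    exchangeSum (sumInsert f) R = (t - (Fintype.card α - 2 * k - 1)) * sumInsert f R := by
  have h1 := sumInsert_sumErase (sumInsert f) R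
  have h2 : sumInsert (sumErase (sumInsert f)) R = (k + 1 + t) * sumInsert f R := by
    rw [sumInsert, sumInsert, Finset.mul_sum]
    refine Finset.sum_congr rfl fun y hy => ?_
    have hc : (insert y R).card = k + 1 := by
      rw [Finset.card_insert_of_notMem (by simpa using hy), hR]
    rw [sumErase_sumInsert, hf _ hc, hc]
    push_cast
    ring
  rw [h2, hR] at h1
  linear_combination -h1

/-- The eigenvalues of the Johnson graph `J(n, k)` are among the numbers `(k - j)(n - k - j) - j`.
The index `j` is the smallest size to which the eigenfunction can be pushed down by summing over
upper covers before it vanishes. -/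
theorem exists_eq_of_exchangeSum_eigen {k : ℕ} {f : Finset α → ℝ} {t : ℝ}
    (hf : ∀ S : Finset α, S.card = k → exchangeSum f S = t * f S)
    {S : Finset α} (hS : S.card = k) (hfS : f S ≠ 0) :
    ∃ j ≤ k, t = ((k : ℝ) - j) * (Fintype.card α - k - j) - j := by
  induction k generalizing f t S with
  | zero =>
    refine ⟨0, le_rfl, ?_⟩
    have h := hf S hS
    rw [Finset.card_eq_zero.mp hS] at h hfS
    have : t = 0 := by simpa [exchangeSum, hfS] using h
    simp [this]
  | succ k ih =>
    by_cases h : ∀ R : Finset α, R.card = k → sumInsert f R = 0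
    · refine ⟨k + 1, le_rfl, ?_⟩
      have h0 : sumErase (sumInsert f) S = 0 :=
        Finset.sum_eq_zero fun x hx => h _ (by rw [Finset.card_erase_of_mem hx, hS]; rfl)
      rw [sumErase_sumInsert, hf S hS, hS, ← add_mul] at h0
      have := (mul_eq_zero.mp h0).resolve_right hfS
      push_cast at this ⊢
      linarith
    · push Not at h
      obtain ⟨R, hR, hne⟩ := h
      obtain ⟨j, hj, e⟩ := ih (fun R hR => exchangeSum_sumInsert hf hR) hR hne
      refine ⟨j, by omega, ?_⟩
      push_cast
      linear_combination e

/-! ### Exchange operators on functions of an intersection size -/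

/-- Exchanging changes `|S ∩ T|` by at most one; this counts the exchanges of each kind, for two
sets `S` and `T` that contain half of the points. -/
lemma exchangeSum_comp_card_inter {w : ℕ} (hα : Fintype.card α = 2 * w) (φ : ℕ → ℝ)
    {S T : Finset α} (hS : S.card = w) (hT : T.card = w) {i : ℕ} (hi : (S ∩ T).card = i) :
    exchangeSum (fun R => φ (R ∩ T).card) S =
      i ^ 2 * φ (i - 1) + 2 * i * (w - i) * φ i + (w - i) ^ 2 * φ (i + 1) := by
  have hST : ((S \ T).card : ℝ) = w - i := by
    have := Finset.card_sdiff_add_card_inter S T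
    rw [hS, hi] at this
    rw [← this]; push_cast; ring
  have hTS : ((Sᶜ ∩ T).card : ℝ) = w - i := by
    have := Finset.card_sdiff_add_card_inter T S
    rw [hT, Finset.inter_comm, hi] at this
    rw [show Sᶜ ∩ T = T \ S by ext; simp [and_comm], ← this]; push_cast; ring
  have hc : ((Sᶜ \ T).card : ℝ) = i := by
    have := Finset.card_sdiff_add_card_inter Sᶜ T
    rw [Finset.card_compl, hα, hS] at this
    have h2 : ((Sᶜ \ T).card : ℝ) + (Sᶜ ∩ T).card = (2 * w - w : ℕ) := by exact_mod_cast this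
    rw [hTS, show 2 * w - w = w by omega] at h2
    linarith
  have inner : ∀ x ∈ S, ∀ y ∈ Sᶜ, ((insert y (S.erase x)) ∩ T).card =
      (if x ∈ T then i - 1 else i) + (if y ∈ T then 1 else 0) := by
    intro x hx y hy
    have hy' : y ∉ S := by simpa using hy
    have he : ((S.erase x) ∩ T).card = if x ∈ T then i - 1 else i := by
      rw [Finset.erase_inter]
      split_ifs with h
      · rw [Finset.card_erase_of_mem (by simp [hx, h]), hi]
      · rw [Finset.erase_eq_of_notMem (by simp [h]), hi]
    split_ifs with h1 h2 h2
    all_goals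
      simp only [h1, if_true, if_false] at he
    · rw [Finset.insert_inter_of_mem h2, Finset.card_insert_of_notMem (by simp [hy']), he]
    · rw [Finset.insert_inter_of_notMem h2, he, add_zero]
    · rw [Finset.insert_inter_of_mem h2, Finset.card_insert_of_notMem (by simp [hy']), he]
    · rw [Finset.insert_inter_of_notMem h2, he, add_zero]
  have row : ∀ a : ℕ, ∑ y ∈ Sᶜ, φ (a + if y ∈ T then 1 else 0) =
      (w - i) * φ (a + 1) + i * φ a := by
    intro a
    have : ∀ y ∈ Sᶜ, φ (a + if y ∈ T then 1 else 0) = if y ∈ T then φ (a + 1) else φ a := by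
      intro y _; split_ifs <;> simp
    rw [Finset.sum_congr rfl this, Finset.sum_ite, Finset.filter_mem_eq_inter,
      Finset.filter_notMem_eq_sdiff]
    simp [hTS, hc]
  have outer : exchangeSum (fun R => φ (R ∩ T).card) S =
      ∑ x ∈ S, if x ∈ T then (w - i) * φ (i - 1 + 1) + i * φ (i - 1)
        else (w - i) * φ (i + 1) + i * φ i := by
    refine Finset.sum_congr rfl fun x hx => ?_
    rw [Finset.sum_congr rfl fun y hy => congrArg φ (inner x hx y hy), row]
    split_ifs <;> rfl
  rw [outer, Finset.sum_ite, Finset.filter_mem_eq_inter, Finset.filter_notMem_eq_sdiff]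
  simp only [Finset.sum_const, nsmul_eq_mul, hST, hi]
  -- for `i = 0` the truncated `i - 1` is harmless, as its term has coefficient zero
  rcases Nat.eq_zero_or_pos i with rfl | hpos
  · push_cast; ring
  · rw [Nat.sub_add_cancel hpos]; ring

lemma exchangeSum_indicator {w : ℕ} (hα : Fintype.card α = 2 * w)
    {S T : Finset α} (hS : S.card = w) (hT : T.card = w) :
    exchangeSum (fun R => if (R ∩ T).card = w then 1 else 0) S =
      if (S ∩ T).card + 1 = w then 1 else 0 := by
  rw [exchangeSum_comp_card_inter hα (fun i => if i = w then 1 else 0) hS hT rfl]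
  have hle : (S ∩ T).card ≤ w := hS ▸ Finset.card_le_card Finset.inter_subset_left
  generalize (S ∩ T).card = i at hle ⊢
  by_cases h1 : i + 1 = w
  · subst h1
    simp
  · by_cases h2 : i = w
    · subst h2
      rcases Nat.eq_zero_or_pos i with rfl | hpos
      · simp
      · simp [show i - 1 ≠ i by omega]
    · simp [h1, h2, show i - 1 ≠ w by omega]

/-- The indicator of a single set is mapped by the quadratic polynomial
`A ^ 2 - (2 * w - 6) * A + (4 - w ^ 2)` in the exchange operator `A` to four times the indicator of
the ball of radius two. -/
lemma exchangeSum_exchangeSum_indicator {w : ℕ} (hw : 2 ≤ w) (hα : Fintype.card α = 2 * w)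
    {S T : Finset α} (hS : S.card = w) (hT : T.card = w) :
    exchangeSum (exchangeSum (fun R => if (R ∩ T).card = w then 1 else 0)) S
      - (2 * w - 6) * exchangeSum (fun R => if (R ∩ T).card = w then 1 else 0) S
      + (4 - w ^ 2) * (if (S ∩ T).card = w then 1 else 0)
      = if w ≤ (S ∩ T).card + 2 then 4 else 0 := by
  rw [exchangeSum_congr (fun R hR => exchangeSum_indicator hα hR hT) hS,
    exchangeSum_indicator hα hS hT,
    exchangeSum_comp_card_inter hα (fun i => if i + 1 = w then 1 else 0) hS hT rfl]
  have hle : (S ∩ T).card ≤ w := hS ▸ Finset.card_le_card Finset.inter_subset_left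
  generalize (S ∩ T).card = i at hle ⊢
  obtain h | h | h | h : i = w ∨ i + 1 = w ∨ i + 2 = w ∨ i + 2 < w := by omega
  · subst h
    simp [show i - 1 + 1 = i by omega]
  · subst h
    simp [show i - 1 ≠ i by omega]
    ring
  · subst h
    simp [show i - 1 ≠ i + 1 by omega]
    ring
  · simp [show i - 1 + 1 ≠ w by omega, show i + 1 ≠ w by omega, show i + 1 + 1 ≠ w by omega,
      show i ≠ w by omega, show ¬ w ≤ i + 2 by omega]

end Exchange

/-! ### Perfect codes in the Johnson graph -/

section Johnson

lemma johnsonGraph_edist_le_two_iff {n w : ℕ} (S T : {s : Finset (Fin n) // s.card = w}) :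
    (johnsonGraph n w).edist S T ≤ ((2 : ℕ) : ℕ∞) ↔ w ≤ (S.1 ∩ T.1).card + 2 := by
  constructor
  · intro h
    have hne : (johnsonGraph n w).edist S T ≠ ⊤ := ne_top_of_le_ne_top (ENat.natCast_ne_top 2) h
    obtain ⟨p, hp⟩ := SimpleGraph.exists_walk_of_edist_ne_top hne
    rw [← hp, Nat.cast_le] at h
    match p, h with
    | .nil, _ => simp [S.2]
    | .cons hadj .nil, _ =>
      have : (S.1 ∩ T.1).card + 1 = w := hadj
      omega
    | .cons (v := R) h1 (.cons h2 .nil), _ =>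
      have h1 : (S.1 ∩ R.1).card + 1 = w := h1
      have h2 : (R.1 ∩ T.1).card + 1 = w := h2
      -- `S ∩ R` and `R ∩ T` lie in the `w`-set `R`, and they meet inside `S ∩ T`
      have h3 := Finset.card_union_add_card_inter (S.1 ∩ R.1) (R.1 ∩ T.1)
      have h4 : (S.1 ∩ R.1 ∪ R.1 ∩ T.1).card ≤ w :=
        (Finset.card_le_card (Finset.union_subset Finset.inter_subset_right
          Finset.inter_subset_left)).trans R.2.le
      have h5 : (S.1 ∩ R.1 ∩ (R.1 ∩ T.1)).card ≤ (S.1 ∩ T.1).card :=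
        Finset.card_le_card (Finset.inter_subset_inter Finset.inter_subset_left
          Finset.inter_subset_right)
      omega
    | .cons _ (.cons _ (.cons _ p)), h =>
      simp only [SimpleGraph.Walk.length_cons] at h
      omega
  · intro h
    have hST := Finset.card_sdiff_add_card_inter S.1 T.1
    have hTS := Finset.card_sdiff_add_card_inter T.1 S.1
    rw [S.2] at hST
    rw [T.2, Finset.inter_comm] at hTS
    obtain h | h | h : (S.1 ∩ T.1).card = w ∨ (S.1 ∩ T.1).card + 1 = w ∨
        (S.1 ∩ T.1).card + 2 = w := by omega
    · have h1 : S.1 ∩ T.1 = S.1 :=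
        Finset.eq_of_subset_of_card_le Finset.inter_subset_left (by rw [S.2, h])
      have h2 : S.1 ∩ T.1 = T.1 :=
        Finset.eq_of_subset_of_card_le Finset.inter_subset_right (by rw [T.2, h])
      have : S = T := Subtype.ext (h1.symm.trans h2)
      simp [this]
    · have hadj : (johnsonGraph n w).Adj S T := h
      refine (SimpleGraph.Walk.edist_le hadj.toWalk).trans ?_
      exact_mod_cast (by simp : hadj.toWalk.length ≤ 2)
    · obtain ⟨x, hx⟩ : (S.1 \ T.1).Nonempty := Finset.card_pos.mp (by omega)
      obtain ⟨y, hy⟩ : (T.1 \ S.1).Nonempty := Finset.card_pos.mp (by omega)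
      rw [Finset.mem_sdiff] at hx hy
      have hyS : y ∉ S.1.erase x := fun h => hy.2 (Finset.mem_of_mem_erase h)
      let R : {s : Finset (Fin n) // s.card = w} := ⟨insert y (S.1.erase x), by
        rw [Finset.card_insert_of_notMem hyS, Finset.card_erase_add_one hx.1, S.2]⟩
      have h1 : (johnsonGraph n w).Adj S R := by
        change (S.1 ∩ insert y (S.1.erase x)).card + 1 = w
        rw [Finset.inter_insert_of_notMem hy.2,
          Finset.inter_eq_right.mpr (Finset.erase_subset _ _), Finset.card_erase_add_one hx.1, S.2]
      have h2 : (johnsonGraph n w).Adj R T := by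
        change (insert y (S.1.erase x) ∩ T.1).card + 1 = w
        rw [Finset.insert_inter_of_mem hy.1, Finset.erase_inter,
          Finset.erase_eq_of_notMem (by simp [hx.2]),
          Finset.card_insert_of_notMem (by simp [hy.2])]
        exact h
      exact SimpleGraph.Walk.edist_le (.cons h1 (.cons h2 .nil))

/-- A vertex of `J(2 * w, w)` at distance exactly two from a given one. -/
lemma exists_card_inter_add_two {w : ℕ} (hw : 2 ≤ w) {T : Finset (Fin (2 * w))}
    (hT : T.card = w) : ∃ S : Finset (Fin (2 * w)), S.card = w ∧ (S ∩ T).card + 2 = w := by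
  obtain ⟨P, hP, hPc⟩ := Finset.exists_subset_card_eq (s := T) (n := w - 2) (by omega)
  obtain ⟨Q, hQ, hQc⟩ := Finset.exists_subset_card_eq (s := Tᶜ) (n := 2)
    (by rw [Finset.card_compl, hT, Fintype.card_fin]; omega)
  have hQT : Disjoint Q T := by
    rw [Finset.disjoint_left]
    intro a ha
    simpa using hQ ha
  refine ⟨P ∪ Q, ?_, ?_⟩
  · rw [Finset.card_union_of_disjoint (hQT.mono_right hP).symm]
    omega
  · rw [Finset.union_inter_distrib_right, Finset.inter_eq_left.mpr hP,
      Finset.disjoint_iff_inter_eq_empty.mp hQT, Finset.union_empty]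
    omega

/-- The smaller root of the Lloyd polynomial of a `2`-perfect code is an eigenvalue of
`J(2 * w, w)`. -/
theorem exists_lloyd_root {w : ℕ} (hw : 2 ≤ w)
    {C : Set {s : Finset (Fin (2 * w)) // s.card = w}}
    (hC : (johnsonGraph (2 * w) w).IsPerfectCode 2 C) :
    ∃ j : ℕ, (w : ℝ) - 3 - √(2 * w ^ 2 - 6 * w + 5) = (w - j) ^ 2 - j := by
  classical
  have hwR : (2 : ℝ) ≤ w := by exact_mod_cast hw
  have hα : Fintype.card (Fin (2 * w)) = 2 * w := Fintype.card_fin _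
  set r : ℝ := √(2 * w ^ 2 - 6 * w + 5) with hr
  have hr2 : r ^ 2 = 2 * w ^ 2 - 6 * w + 5 := Real.sq_sqrt (by nlinarith)
  have hr0 : 0 ≤ r := Real.sqrt_nonneg _
  set t : ℝ := w - 3 - r with ht
  set t' : ℝ := w - 3 + r with ht'
  have hden : (w : ℝ) ^ 2 - t ≠ 0 := by
    have : 0 < (w : ℝ) ^ 2 - t := by nlinarith
    exact this.ne'
  set K : Finset {s : Finset (Fin (2 * w)) // s.card = w} := Finset.univ.filter (· ∈ C) with hK
  set u : Finset (Fin (2 * w)) → ℝ :=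
    fun S => ∑ c ∈ K, if (S ∩ c.1).card = w then 1 else 0 with hu
  have hAu : ∀ S, exchangeSum u S =
      ∑ c ∈ K, exchangeSum (fun R => if (R ∩ c.1).card = w then 1 else 0) S :=
    fun S => exchangeSum_sum _ _ _
  -- every `w`-set is covered by exactly one ball of radius two
  have hcode : ∀ S : Finset (Fin (2 * w)), S.card = w →
      ∃ c ∈ K, w ≤ (S ∩ c.1).card + 2 ∧ ∀ d ∈ K, w ≤ (S ∩ d.1).card + 2 → d = c := by
    intro S hS
    obtain ⟨c, ⟨hcC, hcd⟩, huniq⟩ := hC ⟨S, hS⟩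
    rw [johnsonGraph_edist_le_two_iff] at hcd
    refine ⟨c, by simp [hK, hcC], hcd, fun d hd hSd => huniq d ⟨by simpa [hK] using hd, ?_⟩⟩
    rw [johnsonGraph_edist_le_two_iff]
    exact hSd
  have hquad : ∀ S : Finset (Fin (2 * w)), S.card = w →
      exchangeSum (exchangeSum u) S - (2 * w - 6) * exchangeSum u S + (4 - w ^ 2) * u S = 4 := by
    intro S hS
    obtain ⟨c, hc, hcd, huniq⟩ := hcode S hS
    rw [exchangeSum_congr (k := w) (fun R _ => hAu R) hS, exchangeSum_sum, hAu, hu,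
      Finset.mul_sum, Finset.mul_sum, ← Finset.sum_sub_distrib, ← Finset.sum_add_distrib,
      Finset.sum_congr rfl fun d _ => exchangeSum_exchangeSum_indicator hw hα hS d.2,
      Finset.sum_eq_single_of_mem c hc fun d hd hne => if_neg fun h => hne (huniq d hd h),
      if_pos hcd]
  set F : Finset (Fin (2 * w)) → ℝ :=
    fun S => exchangeSum u S - t' * u S - 4 / (w ^ 2 - t) with hF
  have hFeig : ∀ S : Finset (Fin (2 * w)), S.card = w → exchangeSum F S = t * F S := by
    intro S hS
    have e : exchangeSum F S = exchangeSum (exchangeSum u) S - t' * exchangeSum u S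
        - w ^ 2 * (4 / (w ^ 2 - t)) := by
      rw [hF, exchangeSum_sub (fun T => exchangeSum u T - t' * u T) (fun _ => 4 / (w ^ 2 - t)),
        exchangeSum_sub, exchangeSum_const_mul, exchangeSum_const, hS, hα]
      push_cast
      ring
    have e4 : (w ^ 2 - t) * (4 / ((w : ℝ) ^ 2 - t)) = 4 := mul_div_cancel₀ _ hden
    rw [e, hF]
    linear_combination hquad S hS - e4 - u S * hr2
  -- a vertex at distance two from the code has no codeword in its closed neighbourhood
  obtain ⟨T, -, hT⟩ := Finset.exists_subset_card_eq
    (s := (Finset.univ : Finset (Fin (2 * w)))) (n := w) (by rw [Finset.card_univ, hα]; omega)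
  obtain ⟨c₀, hc₀, -, -⟩ := hcode T hT
  obtain ⟨S, hS, hSc⟩ := exists_card_inter_add_two hw c₀.2
  have hfar : ∀ d ∈ K, (S ∩ d.1).card + 1 ≠ w ∧ (S ∩ d.1).card ≠ w := by
    obtain ⟨c, -, -, huniq⟩ := hcode S hS
    intro d hd
    by_contra hcon
    have hdc : d = c₀ := (huniq d hd (by omega)).trans (huniq c₀ hc₀ (by omega)).symm
    subst hdc
    omega
  have huS : u S = 0 := Finset.sum_eq_zero fun d hd => if_neg (hfar d hd).2
  have hAuS : exchangeSum u S = 0 := by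
    rw [hAu]
    refine Finset.sum_eq_zero fun d hd => ?_
    rw [exchangeSum_indicator hα hS d.2, if_neg (hfar d hd).1]
  have hFS : F S ≠ 0 := by
    simp only [hF, huS, hAuS]
    simpa using hden
  obtain ⟨j, -, hj⟩ := exists_eq_of_exchangeSum_eigen hFeig hS hFS
  refine ⟨j, ?_⟩
  rw [hj, hα]
  push_cast
  ring

end Johnson

/-! ### The Pell equation -/

/-- The solutions of the negative Pell equation `x ^ 2 - 2 * y ^ 2 = -1` are given by the odd
powers of `1 + √2`; descent along `(x, y) ↦ (3 * x - 4 * y, 3 * y - 2 * x)`, which is division by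
`(1 + √2) ^ 2 = 3 + 2 * √2`. -/
lemma exists_odd_pow_of_negative_pell (y : ℕ) : ∀ x : ℤ, 0 < x → x ^ 2 + 1 = 2 * (y : ℤ) ^ 2 →
    ∃ m : ℕ, (x : ℝ) + y * √2 = (1 + √2) ^ (2 * m + 1) ∧
      (x : ℝ) - y * √2 = (1 - √2) ^ (2 * m + 1) := by
  induction y using Nat.strong_induction_on with
  | _ y ih =>
    intro x hx h
    have h2 : √2 ^ 2 = (2 : ℝ) := Real.sq_sqrt (by norm_num)
    have hy0 : (0 : ℤ) ≤ y := by positivity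
    by_cases hy : y ≤ 1
    · have hy1 : (y : ℤ) ≤ 1 := by exact_mod_cast hy
      have hy : y = 1 := by
        have : (0 : ℤ) < y := by nlinarith
        omega
      subst hy
      have hx1 : x = 1 := by push_cast at h; nlinarith
      subst hx1
      exact ⟨0, by simp, by simp⟩
    · have hy2 : (2 : ℤ) ≤ y := by exact_mod_cast (not_le.mp hy)
      have hyx : (y : ℤ) < x := by nlinarith
      have hxy : 2 * x < 3 * y := by nlinarith
      have hx' : 0 < 3 * x - 4 * y := by nlinarith
      obtain ⟨z, hz⟩ := Int.eq_ofNat_of_zero_le (show 0 ≤ 3 * (y : ℤ) - 2 * x by linarith)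
      have hzR : (z : ℝ) = 3 * y - 2 * x := by exact_mod_cast hz.symm
      obtain ⟨m, hm1, hm2⟩ := ih z (by omega) (3 * x - 4 * y) hx' (by
        rw [← hz]; linear_combination h)
      push_cast at hm1 hm2
      rw [hzR] at hm1 hm2
      refine ⟨m + 1, ?_, ?_⟩
      · rw [show 2 * (m + 1) + 1 = 2 * m + 1 + 2 by ring, pow_add, ← hm1]
        linear_combination (-(x : ℝ) * 3 + 4 * y - (3 * y - 2 * x) * √2 - 2 * (3 * y - 2 * x)) * h2
      · rw [show 2 * (m + 1) + 1 = 2 * m + 1 + 2 by ring, pow_add, ← hm2]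
        linear_combination (-(x : ℝ) * 3 + 4 * y + (3 * y - 2 * x) * √2 - 2 * (3 * y - 2 * x)) * h2

/-! ### The weights that admit a perfect code -/

theorem mainTheorem3 (w : ℕ) (hw : 2 ≤ w)
    (C : Set {s : Finset (Fin (2 * w)) // s.card = w})
    (hC : (johnsonGraph (2 * w) w).IsPerfectCode 2 C) :
    ∃ m : ℕ,
      (w : ℝ) = ((1 + Real.sqrt 2) ^ (2 * m + 1) + (1 - Real.sqrt 2) ^ (2 * m + 1) + 6) / 4 ∧
      ∃ s : ℤ,
        Real.sqrt 2 * ((1 + Real.sqrt 2) ^ (2 * m) - (1 - Real.sqrt 2) ^ (2 * m)) + 1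
          = (s : ℝ) ^ 2 := by
  obtain ⟨j, hj⟩ := exists_lloyd_root hw hC
  have hwR : (2 : ℝ) ≤ w := by exact_mod_cast hw
  set r : ℝ := √(2 * w ^ 2 - 6 * w + 5) with hr
  have hr2 : r ^ 2 = 2 * w ^ 2 - 6 * w + 5 := Real.sq_sqrt (by nlinarith)
  have hr0 : 0 ≤ r := Real.sqrt_nonneg _
  -- the eigenvalue is an integer, hence so is the square root of the discriminant
  have hri : r = ((w - 3 - ((w - j) ^ 2 - j) : ℤ) : ℝ) := by
    push_cast
    linarith
  obtain ⟨y, hy⟩ := Int.eq_ofNat_of_zero_le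
    (show (0 : ℤ) ≤ w - 3 - ((w - j) ^ 2 - j) by rw [hri] at hr0; exact_mod_cast hr0)
  rw [hy, Int.cast_natCast] at hri
  have hpell : (2 * (w : ℤ) - 3) ^ 2 + 1 = 2 * (y : ℤ) ^ 2 := by
    have : (2 * (w : ℝ) - 3) ^ 2 + 1 = 2 * (y : ℝ) ^ 2 := by
      rw [← hri]; linear_combination -2 * hr2
    exact_mod_cast this
  obtain ⟨m, h1, h2⟩ := exists_odd_pow_of_negative_pell y (2 * w - 3) (by omega) hpell
  push_cast at h1 h2
  have hs : √2 ^ 2 = (2 : ℝ) := Real.sq_sqrt (by norm_num)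
  refine ⟨m, ?_, 2 * w + 1 - 2 * j, ?_⟩
  · rw [← h1, ← h2]; ring
  · have e1 : (1 + √2) ^ (2 * m) = (2 * w - 3 + y * √2) * (√2 - 1) := by
      rw [h1, pow_succ]; linear_combination -(1 + √2) ^ (2 * m) * hs
    have e2 : (1 - √2) ^ (2 * m) = (2 * w - 3 - y * √2) * (-1 - √2) := by
      rw [h2, pow_succ]; linear_combination -(1 - √2) ^ (2 * m) * hs
    rw [e1, e2]
    rw [hri] at hj
    push_cast
    linear_combination 4 * hj + (4 * w - 6 - 2 * y) * hs
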